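/- Let $\alpha>2$, $\beta>0$, and let $J:\mathbb N\to\mathbb R$ satisfy $J(k)=O(k^{-\alpha})$ as $k\to\infty$; no sign is assumed, and in particular $J(k)\sim k^{-\alpha}$ is allowed. For $p\in[1,2]$ put $V(x)=|x|^p$ and consider $\mathbb Z$-valued fields $\phi=(\phi_i)_{i\in\mathbb Z}\in\Omega=\mathbb Z^{\mathbb Z}$ with formal Hamiltonian $$H(\phi)=\sum_{i\neq j\in\mathbb Z}J(|i-j|)\,V(\phi_i-\phi_j).$$ For finite $\Lambda\subset\mathbb Z$ and $\omega\in\Omega$ let $\mu_\Lambda^\omega$ be the probability measure on the countable set $\{\phi\in\Omega:\phi_i=\omega_i\text{ for all }i\notin\Lambda\}$ with weights proportional to $\exp(-\beta H_\Lambda(\phi))$, where $H_\Lambda$ is the sum of the terms of $H$ with $i\in\Lambda$ or $j\in\Lambda$; it is defined when these sums converge absolutely and the total weight is finite. A Gibbs measure is a probability measure $\mu$ on $\Omega$ (with the product $\sigma$-algebra) such that for every finite $\Lambda\subset\mathbb Z$ the measure $\mu_\Lambda^\omega$ is defined for $\mu$-almost every $\omega$ and $\mu=\int\mu_\Lambda^\omega\,d\mu(\omega)$.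 It is shift-invariant if it is invariant under all translations of $\mathbb Z$. Then delocalisation holds in the following sense. 1. If $p\in\{1,2\}$ (the SOS model and the Discrete Gaussian Chain), there is no shift-invariant Gibbs measure $\mu$ with $\langle|\phi_0|\rangle_\mu<C$ for some finite constant $C$. 2. If $p\in(1,2)$, there is no shift-invariant Gibbs measure $\mu$ with $\langle\phi_0^2\rangle_\mu<C$ for some finite constant $C$. -/

import Mathlib

open MeasureTheory Filter
open scoped ENNReal NNReal

noncomputable section

namespace LongRangeSOS

/-- Height configurations `φ : ℤ → ℤ`, with the product σ-algebra. -/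
abbrev Config : Type := ℤ → ℤ

/-- The potential `V(x) = |x|^p`. -/
def V (p : ℝ) (x : ℤ) : ℝ := |(x : ℝ)| ^ p

/-- The contribution `J(|i - j|) V(φ_i - φ_j)` of the ordered pair `(i, j)`, `i ≠ j`, to the energy
in the volume `Λ`; only the pairs that meet `Λ` contribute. -/
def energyTerm (p : ℝ) (J : ℕ → ℝ) (Λ : Finset ℤ) (φ : Config) (ij : ℤ × ℤ) : ℝ :=
  if ij.1 ≠ ij.2 ∧ (ij.1 ∈ Λ ∨ ij.2 ∈ Λ) then
    J (ij.1 - ij.2).natAbs * V p (φ ij.1 - φ ij.2)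
  else 0

/-- The energy in the volume `Λ`: the part of the formal Hamiltonian
`H(φ) = ∑_{i ≠ j} J(|i - j|) V(φ_i - φ_j)` that depends on the heights in `Λ`. -/
def energy (p : ℝ) (J : ℕ → ℝ) (Λ : Finset ℤ) (φ : Config) : ℝ :=
  ∑' ij : ℤ × ℤ, energyTerm p J Λ φ ij

/-- The configuration equal to `η` in `Λ` and to the boundary condition `ω` outside `Λ`. -/
def glue (Λ : Finset ℤ) (η : Λ → ℤ) (ω : Config) : Config :=
  fun i => if h : i ∈ Λ then η ⟨i, h⟩ else ω i

/-- The Boltzmann weight `exp(-β H_Λ(φ))`. -/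
def weight (β p : ℝ) (J : ℕ → ℝ) (Λ : Finset ℤ) (φ : Config) : ℝ≥0∞ :=
  ENNReal.ofReal (Real.exp (-β * energy p J Λ φ))

/-- The partition function in `Λ` with boundary condition `ω`. -/
def partitionFn (β p : ℝ) (J : ℕ → ℝ) (Λ : Finset ℤ) (ω : Config) : ℝ≥0∞ :=
  ∑' η : Λ → ℤ, weight β p J Λ (glue Λ η ω)

open Classical in
/-- The finite-volume measure `μ_Λ^ω`: a probability measure, when the energies converge
(absolutely) and the partition function is finite. Otherwise there is no such measure and the value
is the zero measure (in `ℝ≥0∞` one has `∞⁻¹ = 0`). -/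
def finiteVolume (β p : ℝ) (J : ℕ → ℝ) (Λ : Finset ℤ) (ω : Config) : Measure Config :=
  if ∀ η : Λ → ℤ, Summable (energyTerm p J Λ (glue Λ η ω)) then
    (partitionFn β p J Λ ω)⁻¹ •
      Measure.sum fun η : Λ → ℤ => weight β p J Λ (glue Λ η ω) • Measure.dirac (glue Λ η ω)
  else 0

/-- Gibbs measures: probability measures with `μ = ∫ μ_Λ^ω dμ(ω)` for all finite `Λ`.
Since `μ` has total mass one, the equation with `A = Set.univ` forces `μ_Λ^ω` to be a genuine
probability measure for `μ`-almost every `ω`. -/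
structure IsGibbs (β p : ℝ) (J : ℕ → ℝ) (μ : Measure Config) : Prop where
  isProbabilityMeasure : IsProbabilityMeasure μ
  dlr : ∀ (Λ : Finset ℤ) (A : Set Config), MeasurableSet A →
    μ A = ∫⁻ ω, finiteVolume β p J Λ ω A ∂μ

/-- Invariance under all translations of `ℤ`. -/
def IsShiftInvariant (μ : Measure Config) : Prop :=
  ∀ v : ℤ, μ.map (fun φ i => φ (i + v)) = μ

end LongRangeSOS

end

/-! ### Mean ergodic theorem in L² and L¹. -/

section MeanErgodic

variable {X : Type*} [MeasurableSpace X] {μ : Measure X} {T : X → X}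

/-! Suppose the first moment is finite. Raising the heights on `{0, …, n - 1}` by one has expected
energy cost bounded uniformly in `n`: increments of `|x|^p`, `p ≤ 2`, grow at most linearly, and `∑
d |J d| < ∞` because `α > 2` (`lintegral_raiseCost_Ico_le`). By the DLR equations, an event on which
the cost is at most `K` keeps at least the fraction `exp (-β K)` of its probability when raised
(`IsGibbs.mul_measure_le`).

The raise moves the mean height over `n` sites by 1 and that over `4n` sites by 1/4, so their
difference moves by 3/4. By the mean ergodic theorem this difference is small in L¹ for large `n`. A
raised event of probability bounded below therefore lies in an event of arbitrarily small
probability, a contradiction. Only the Cauchy property of the averages enters, so ergodicity of `μ`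
is not needed. -/

theorem memLp_birkhoffAverage {p : ℝ≥0∞} (hT : MeasurePreserving T μ μ) {f : X → ℝ}
    (hf : MemLp f p μ) (n : ℕ) : MemLp (birkhoffAverage ℝ T f n) p μ := by
  have h : birkhoffAverage ℝ T f n
      = (n : ℝ)⁻¹ • fun x => ∑ k ∈ Finset.range n, (f ∘ T^[k]) x := by
    ext x
    simp [birkhoffAverage, birkhoffSum]
  rw [h]
  exact (memLp_finsetSum _ fun k _ => hf.comp_measurePreserving (hT.iterate k)).const_smul _

/-- Birkhoff averages do not increase the `L¹` norm. -/
theorem eLpNorm_birkhoffAverage_le (hT : MeasurePreserving T μ μ) {f : X → ℝ}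
    (hf : AEStronglyMeasurable f μ) (n : ℕ) :
    eLpNorm (birkhoffAverage ℝ T f n) 1 μ ≤ eLpNorm f 1 μ := by
  rcases Nat.eq_zero_or_pos n with rfl | hn
  · simp
  have h : birkhoffAverage ℝ T f n = (n : ℝ)⁻¹ • ∑ k ∈ Finset.range n, f ∘ T^[k] := by
    ext x
    simp [birkhoffAverage, birkhoffSum]
  have hsum : eLpNorm (∑ k ∈ Finset.range n, f ∘ T^[k]) 1 μ ≤ n * eLpNorm f 1 μ := by
    refine (eLpNorm_sum_le (fun k _ => hf.comp_measurePreserving (hT.iterate k)) le_rfl).trans ?_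
    simp [eLpNorm_comp_measurePreserving hf (hT.iterate _)]
  rw [h, eLpNorm_const_smul]
  have hn' : (n : ℝ≥0∞) ≠ 0 := by simpa using hn.ne'
  calc ‖(n : ℝ)⁻¹‖ₑ * eLpNorm (∑ k ∈ Finset.range n, f ∘ T^[k]) 1 μ
      ≤ (n : ℝ≥0∞)⁻¹ * (n * eLpNorm f 1 μ) := by
        gcongr
        rw [enorm_inv (by positivity)]
        simp
    _ = eLpNorm f 1 μ := by
        rw [← mul_assoc, ENNReal.inv_mul_cancel hn' (by simp), one_mul]

/-- The mean ergodic theorem in `L²`, as a Cauchy property of Birkhoff averages. -/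
theorem exists_eLpNorm_two_birkhoffAverage_sub_le (hT : MeasurePreserving T μ μ) {f : X → ℝ}
    (hf : MemLp f 2 μ) {ε : ℝ≥0∞} (hε : ε ≠ 0) :
    ∃ N : ℕ, ∀ n ≥ N, ∀ m ≥ N,
      eLpNorm (birkhoffAverage ℝ T f n - birkhoffAverage ℝ T f m) 2 μ ≤ ε := by
  let U : Lp ℝ 2 μ →L[ℝ] Lp ℝ 2 μ :=
    (Lp.compMeasurePreservingₗᵢ ℝ T hT).toContinuousLinearMap
  have hU : ∀ g, U g = Lp.compMeasurePreserving T hT g := fun _ => rfl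
  have hU1 : ‖U‖ ≤ 1 := LinearIsometry.norm_toContinuousLinearMap_le _
  have hiter : ∀ k, U^[k] (hf.toLp f)
      = (hf.comp_measurePreserving (hT.iterate k)).toLp (f ∘ T^[k]) := by
    intro k
    have : (⇑U)^[k] = Lp.compMeasurePreserving T^[k] (hT.iterate k) := by
      rw [← Lp.compMeasurePreserving_iterate]
      rfl
    rw [this, Lp.toLp_compMeasurePreserving]
  have havg : ∀ n, birkhoffAverage ℝ U id n (hf.toLp f)
      = (memLp_birkhoffAverage hT hf n).toLp (birkhoffAverage ℝ T f n) := by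
    intro n
    have hs : ∀ n, ∃ h : MemLp (birkhoffSum T f n) 2 μ,
        birkhoffSum U id n (hf.toLp f) = h.toLp _ := by
      intro n
      induction n with
      | zero => exact ⟨by simp [birkhoffSum_zero'], by simp [birkhoffSum_zero]⟩
      | succ k ih =>
        obtain ⟨h, hk⟩ := ih
        have e : birkhoffSum T f (k + 1) = birkhoffSum T f k + f ∘ T^[k] := by
          ext x; simp [birkhoffSum_succ]
        refine ⟨e ▸ h.add (hf.comp_measurePreserving (hT.iterate k)), ?_⟩
        rw [birkhoffSum_succ, hk, id, hiter, ← MemLp.toLp_add]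
        simp only [e]
    obtain ⟨h, hk⟩ := hs n
    rw [birkhoffAverage, hk, ← MemLp.toLp_const_smul]
    rfl
  -- Von Neumann's theorem for the Koopman operator, a contraction of L².
  have hc := (U.tendsto_birkhoffAverage_orthogonalProjection hU1 (hf.toLp f)).cauchySeq
  obtain ⟨N, hN⟩ := EMetric.cauchySeq_iff.1 hc ε (pos_iff_ne_zero.2 hε)
  refine ⟨N, fun n hn m hm => ?_⟩
  have := (hN n hn m hm).le
  rwa [havg, havg, Lp.edist_toLp_toLp] at this

/-- The mean ergodic theorem in `L¹`, as a Cauchy property of Birkhoff averages. -/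
theorem exists_eLpNorm_one_birkhoffAverage_sub_le [IsProbabilityMeasure μ]
    (hT : MeasurePreserving T μ μ) {f : X → ℝ} (hf : MemLp f 1 μ) {ε : ℝ≥0∞} (hε : ε ≠ 0) :
    ∃ N : ℕ, ∀ n ≥ N, ∀ m ≥ N,
      eLpNorm (birkhoffAverage ℝ T f n - birkhoffAverage ℝ T f m) 1 μ ≤ ε := by
  have hε3 : ε / 3 ≠ 0 := by simp [ENNReal.div_eq_zero_iff, hε]
  -- Simple functions are dense in L¹ and lie in L². The error `f - g` costs ε/3 in each of the two
  -- averages, as averaging is an L¹ contraction.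
  obtain ⟨g, hg, hg1⟩ := hf.exists_simpleFunc_eLpNorm_sub_lt (by simp) hε3
  have hg2 : MemLp g 2 μ := g.memLp_of_isFiniteMeasure 2 μ
  obtain ⟨N, hN⟩ := exists_eLpNorm_two_birkhoffAverage_sub_le hT hg2 hε3
  refine ⟨N, fun n hn m hm => ?_⟩
  have hd : AEStronglyMeasurable (f - ⇑g) μ := (hf.sub hg1).1
  have hA : ∀ k, birkhoffAverage ℝ T f k
      = birkhoffAverage ℝ T (f - ⇑g) k + birkhoffAverage ℝ T g k := by
    intro k
    ext x
    simp [birkhoffAverage, birkhoffSum, Finset.sum_sub_distrib, mul_sub]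
  have hmem : ∀ k, AEStronglyMeasurable (birkhoffAverage ℝ T (f - ⇑g) k) μ := fun k =>
    (memLp_birkhoffAverage hT (hf.sub hg1) k).1
  have hmemg : ∀ k, AEStronglyMeasurable (birkhoffAverage ℝ T g k) μ := fun k =>
    (memLp_birkhoffAverage hT hg1 k).1
  have e : birkhoffAverage ℝ T f n - birkhoffAverage ℝ T f m
      = (birkhoffAverage ℝ T (f - ⇑g) n - birkhoffAverage ℝ T (f - ⇑g) m)
        + (birkhoffAverage ℝ T g n - birkhoffAverage ℝ T g m) := by
    rw [hA n, hA m]; abel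
  rw [e]
  calc _ ≤ eLpNorm (birkhoffAverage ℝ T (f - ⇑g) n) 1 μ
          + eLpNorm (birkhoffAverage ℝ T (f - ⇑g) m) 1 μ
          + eLpNorm (birkhoffAverage ℝ T g n - birkhoffAverage ℝ T g m) 2 μ := by
        refine (eLpNorm_add_le ((hmem n).sub (hmem m)) ((hmemg n).sub (hmemg m)) le_rfl).trans ?_
        gcongr
        · exact eLpNorm_sub_le (hmem n) (hmem m) le_rfl
        · exact eLpNorm_le_eLpNorm_of_exponent_le (by norm_num) ((hmemg n).sub (hmemg m))
    _ ≤ ε / 3 + ε / 3 + ε / 3 := by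
        gcongr
        · exact (eLpNorm_birkhoffAverage_le hT hd n).trans hg.le
        · exact (eLpNorm_birkhoffAverage_le hT hd m).trans hg.le
        · exact hN n hn m hm
    _ = ε := ENNReal.add_thirds ε

end MeanErgodic

/-! ### Raising heights and its effect on Gibbs measures. -/

namespace LongRangeSOS

/-- Raising the heights in `Λ` by the integer `c`. -/
def raise (Λ : Finset ℤ) (c : ℤ) (φ : Config) : Config :=
  fun i => if i ∈ Λ then φ i + c else φ i

theorem measurable_raise (Λ : Finset ℤ) (c : ℤ) : Measurable (raise Λ c) := by
  refine measurable_pi_lambda _ fun i => ?_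
  unfold raise
  have hi : Measurable fun φ : Config => φ i := measurable_pi_apply i
  by_cases h : i ∈ Λ
  · simpa [h] using hi.add_const c
  · simpa [h] using hi

theorem raise_neg_raise (Λ : Finset ℤ) (c : ℤ) (φ : Config) : raise Λ (-c) (raise Λ c φ) = φ := by
  ext i
  by_cases h : i ∈ Λ <;> simp [raise, h]

theorem raise_raise_neg (Λ : Finset ℤ) (c : ℤ) (φ : Config) : raise Λ c (raise Λ (-c) φ) = φ := by
  simpa using raise_neg_raise Λ (-c) φ

theorem raise_glue (Λ : Finset ℤ) (c : ℤ) (η : Λ → ℤ) (ω : Config) :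
    raise Λ c (glue Λ η ω) = glue Λ (fun i => η i + c) ω := by
  ext i
  by_cases h : i ∈ Λ <;> simp [raise, glue, h]

/-- An upper bound for the energy cost of raising the heights in `Λ` by one. -/
noncomputable def raiseCost (p : ℝ) (J : ℕ → ℝ) (Λ : Finset ℤ) (φ : Config) : ℝ≥0∞ :=
  ∑' ij : ℤ × ℤ, ‖energyTerm p J Λ (raise Λ 1 φ) ij - energyTerm p J Λ φ ij‖ₑ

theorem measurable_energyTerm (p : ℝ) (J : ℕ → ℝ) (Λ : Finset ℤ) (ij : ℤ × ℤ) :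
    Measurable fun φ => energyTerm p J Λ φ ij := by
  unfold energyTerm
  split_ifs
  · refine Measurable.const_mul ?_ _
    exact (measurable_from_top (f := V p)).comp
      ((measurable_pi_apply ij.1).sub (measurable_pi_apply ij.2))
  · exact measurable_const

theorem measurable_enorm_energyTerm_raise_sub (p : ℝ) (J : ℕ → ℝ) (Λ : Finset ℤ) (ij : ℤ × ℤ) :
    Measurable fun φ => ‖energyTerm p J Λ (raise Λ 1 φ) ij - energyTerm p J Λ φ ij‖ₑ :=
  (((measurable_energyTerm p J Λ ij).comp (measurable_raise Λ 1)).sub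
    (measurable_energyTerm p J Λ ij)).enorm

theorem measurable_raiseCost (p : ℝ) (J : ℕ → ℝ) (Λ : Finset ℤ) :
    Measurable (raiseCost p J Λ) :=
  Measurable.tsum fun ij => measurable_enorm_energyTerm_raise_sub p J Λ ij

/-- Both energies must be summable for their difference to be the sum of the termwise differences; a
divergent `tsum` would be 0. -/
theorem mul_weight_le_weight_raise {β p : ℝ} (hβ : 0 < β) {J : ℕ → ℝ} {Λ : Finset ℤ} {φ : Config}
    {K : ℝ≥0} (h : Summable (energyTerm p J Λ φ))
    (h' : Summable (energyTerm p J Λ (raise Λ 1 φ))) (hK : raiseCost p J Λ φ ≤ K) :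
    ENNReal.ofReal (Real.exp (-β * K)) * weight β p J Λ φ ≤ weight β p J Λ (raise Λ 1 φ) := by
  have hE : energy p J Λ (raise Λ 1 φ) - energy p J Λ φ ≤ K := by
    unfold energy
    rw [← h'.tsum_sub h]
    have hle : ‖∑' ij, (energyTerm p J Λ (raise Λ 1 φ) ij - energyTerm p J Λ φ ij)‖ₑ ≤ K :=
      (enorm_tsum_le_tsum_enorm).trans hK
    rw [← ofReal_norm, ← ENNReal.ofReal_coe_nnreal,
      ENNReal.ofReal_le_ofReal_iff K.coe_nonneg] at hle
    exact (Real.le_norm_self _).trans hle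
  unfold weight
  rw [← ENNReal.ofReal_mul (Real.exp_pos _).le, ← Real.exp_add]
  refine ENNReal.ofReal_le_ofReal (Real.exp_le_exp.2 ?_)
  nlinarith

/-- Raising heights decreases the finite-volume measure of an event of bounded cost at most by a
constant factor. -/
theorem mul_finiteVolume_le {β p : ℝ} (hβ : 0 < β) (J : ℕ → ℝ) (Λ : Finset ℤ) (ω : Config)
    {K : ℝ≥0} {F : Set Config} (hF : MeasurableSet F) (hK : ∀ φ ∈ F, raiseCost p J Λ φ ≤ K) :
    ENNReal.ofReal (Real.exp (-β * K)) * finiteVolume β p J Λ ω F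
      ≤ finiteVolume β p J Λ ω (raise Λ (-1) ⁻¹' F) := by
  unfold finiteVolume
  split_ifs with h
  · have hF' : MeasurableSet (raise Λ (-1) ⁻¹' F) := measurable_raise Λ (-1) hF
    simp only [Measure.smul_apply, smul_eq_mul, Measure.sum_apply _ hF, Measure.sum_apply _ hF',
      Measure.dirac_apply' _ hF, Measure.dirac_apply' _ hF']
    rw [mul_left_comm]
    refine mul_le_mul_right ?_ _
    rw [← ENNReal.tsum_mul_left]
    -- Raising permutes the configurations in `Λ`, so the right-hand sum can be reindexed and
    -- compared term by term.
    conv_rhs => rw [← (Equiv.addRight (fun _ : Λ => (1 : ℤ))).tsum_eq]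
    refine ENNReal.tsum_le_tsum fun η => ?_
    have e : glue Λ ((Equiv.addRight (fun _ : Λ => (1 : ℤ))) η) ω = raise Λ 1 (glue Λ η ω) := by
      rw [raise_glue]; rfl
    have hs := h ((Equiv.addRight (fun _ : Λ => (1 : ℤ))) η)
    rw [e] at hs ⊢
    by_cases hm : glue Λ η ω ∈ F
    · have hm' : raise Λ 1 (glue Λ η ω) ∈ raise Λ (-1) ⁻¹' F := by
        rwa [Set.mem_preimage, raise_neg_raise]
      simpa [hm, hm'] using mul_weight_le_weight_raise hβ (h η) hs (hK _ hm)
    · simp [hm]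
  · simp

theorem IsGibbs.mul_measure_le {β p : ℝ} (hβ : 0 < β) {J : ℕ → ℝ} {μ : Measure Config}
    (hμ : IsGibbs β p J μ) (Λ : Finset ℤ) {K : ℝ≥0} {F : Set Config} (hF : MeasurableSet F)
    (hK : ∀ φ ∈ F, raiseCost p J Λ φ ≤ K) :
    ENNReal.ofReal (Real.exp (-β * K)) * μ F ≤ μ (raise Λ (-1) ⁻¹' F) := by
  rw [hμ.dlr Λ F hF, hμ.dlr Λ _ (measurable_raise Λ (-1) hF),
    ← lintegral_const_mul' _ _ ENNReal.ofReal_ne_top]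
  exact lintegral_mono fun ω => mul_finiteVolume_le hβ J Λ ω hF hK

/-! ### Energy cost of raising an interval. -/

/-- Bernoulli's inequality at `b / a` gives the tangent bound `p * a ^ (p - 1) * (a - b)`, and `a ^
(p - 1) ≤ 1 + a` since `0 ≤ p - 1 ≤ 1`. -/
theorem rpow_sub_rpow_le {p a b : ℝ} (hp1 : 1 ≤ p) (hp2 : p ≤ 2) (hb : 0 ≤ b) (hab : b ≤ a) :
    a ^ p - b ^ p ≤ 2 * (1 + a) * (a - b) := by
  rcases (hb.trans hab).eq_or_lt with h0 | ha
  · obtain rfl : b = 0 := le_antisymm (h0 ▸ hab) hb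
    simp [← h0]
  have hB := one_add_mul_self_le_rpow_one_add (s := b / a - 1) (p := p)
    (by have : 0 ≤ b / a := by positivity
        linarith) hp1
  rw [add_sub_cancel, Real.div_rpow hb ha.le, le_div_iff₀ (by positivity)] at hB
  have hpow : a ^ p = a ^ (p - 1) * a := by
    rw [← Real.rpow_add_one ha.ne', sub_add_cancel]
  have hle : a ^ (p - 1) ≤ 1 + a := by
    rcases le_total a 1 with h | h
    · exact (Real.rpow_le_one ha.le h (by linarith)).trans (by linarith)
    · calc a ^ (p - 1) ≤ a ^ (1 : ℝ) := Real.rpow_le_rpow_of_exponent_le h (by linarith)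
        _ ≤ 1 + a := by rw [Real.rpow_one]; linarith
  have h1 : a ^ p - b ^ p ≤ p * a ^ (p - 1) * (a - b) := by
    have : (1 + p * (b / a - 1)) * a ^ p = a ^ p - p * a ^ (p - 1) * (a - b) := by
      rw [hpow]; field_simp; ring
    linarith
  refine h1.trans (mul_le_mul_of_nonneg_right ?_ (by linarith))
  exact mul_le_mul hp2 hle (by positivity) (by norm_num)

/-- Linear growth in `y` is what lets a first moment suffice even for `p = 2`. -/
theorem abs_V_sub_V_le {p : ℝ} (hp1 : 1 ≤ p) (hp2 : p ≤ 2) {x y : ℤ} (h : |x - y| ≤ 1) :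
    |V p x - V p y| ≤ 4 + 2 * |(y : ℝ)| := by
  have h' : |(x : ℝ) - y| ≤ 1 := by exact_mod_cast h
  have hxy := (abs_abs_sub_abs_le_abs_sub (x : ℝ) y).trans h'
  rw [abs_le] at hxy
  have hx := abs_nonneg (x : ℝ)
  have hy := abs_nonneg (y : ℝ)
  unfold V
  rcases le_total |(x : ℝ)| |(y : ℝ)| with hle | hle
  · rw [abs_sub_comm, abs_of_nonneg (sub_nonneg.2 (Real.rpow_le_rpow hx hle (by linarith)))]
    refine (rpow_sub_rpow_le hp1 hp2 hx hle).trans ?_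
    nlinarith
  · rw [abs_of_nonneg (sub_nonneg.2 (Real.rpow_le_rpow hy hle (by linarith)))]
    refine (rpow_sub_rpow_le hp1 hp2 hy hle).trans ?_
    nlinarith

/-- The absolute coupling of the ordered pair `ij` if it leads from `Λ` to its complement. -/
noncomputable def exitCoupling (J : ℕ → ℝ) (Λ : Finset ℤ) (ij : ℤ × ℤ) : ℝ≥0∞ :=
  if ij.1 ∈ Λ ∧ ij.2 ∉ Λ then ‖J (ij.1 - ij.2).natAbs‖ₑ else 0

/-- Pairs inside `Λ` keep their height difference; only pairs crossing the boundary, in either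
order, change, and by one unit. -/
theorem enorm_energyTerm_raise_sub_le {p : ℝ} (hp1 : 1 ≤ p) (hp2 : p ≤ 2) (J : ℕ → ℝ)
    (Λ : Finset ℤ) (φ : Config) (ij : ℤ × ℤ) :
    ‖energyTerm p J Λ (raise Λ 1 φ) ij - energyTerm p J Λ φ ij‖ₑ
      ≤ (exitCoupling J Λ ij + exitCoupling J Λ ij.swap) *
        (4 + 2 * (ENNReal.ofReal |(φ ij.1 : ℝ)| + ENNReal.ofReal |(φ ij.2 : ℝ)|)) := by
  obtain ⟨i, j⟩ := ij
  have key : ∀ x : ℤ, |x - (φ i - φ j)| ≤ 1 →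
      ‖J (i - j).natAbs * V p x - J (i - j).natAbs * V p (φ i - φ j)‖ₑ
        ≤ ‖J (i - j).natAbs‖ₑ *
          (4 + 2 * (ENNReal.ofReal |(φ i : ℝ)| + ENNReal.ofReal |(φ j : ℝ)|)) := by
    intro x hx
    rw [← mul_sub, enorm_mul]
    gcongr
    have h1 := abs_V_sub_V_le hp1 hp2 hx
    have h2 : |((φ i - φ j : ℤ) : ℝ)| ≤ |(φ i : ℝ)| + |(φ j : ℝ)| := by
      push_cast; exact abs_sub _ _
    calc ‖V p x - V p (φ i - φ j)‖ₑ
        ≤ ENNReal.ofReal (4 + 2 * (|(φ i : ℝ)| + |(φ j : ℝ)|)) := by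
          rw [Real.enorm_eq_ofReal_abs]
          exact ENNReal.ofReal_le_ofReal (by linarith)
      _ = _ := by
          rw [ENNReal.ofReal_add (by norm_num) (by positivity), ENNReal.ofReal_mul (by norm_num),
            ENNReal.ofReal_add (by positivity) (by positivity)]
          norm_num
  by_cases hi : i ∈ Λ <;> by_cases hj : j ∈ Λ
  · simp [energyTerm, raise, hi, hj]
  · have hij : i ≠ j := fun h => hj (h ▸ hi)
    simpa [energyTerm, raise, exitCoupling, hi, hj, hij] using
      key (φ i + 1 - φ j) (by ring_nf; simp)
  · have hij : i ≠ j := fun h => hi (h ▸ hj)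
    have hs : (j - i).natAbs = (i - j).natAbs := by omega
    simpa [energyTerm, raise, exitCoupling, hi, hj, hij, hs] using
      key (φ i - (φ j + 1)) (by ring_nf; simp)
  · simp [energyTerm, hi, hj]

/-- For a fixed displacement `d`, at most `|d|` sites of an interval leave it, whatever its length.
-/
theorem tsum_exitCoupling_Ico_le (J : ℕ → ℝ) (n : ℕ) :
    ∑' ij, exitCoupling J (Finset.Ico 0 (n : ℤ)) ij ≤ ∑' d : ℤ, d.natAbs * ‖J d.natAbs‖ₑ := by
  have hre : ∑' ij, exitCoupling J (Finset.Ico 0 (n : ℤ)) ij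
      = ∑' d : ℤ, ∑' i : ℤ, exitCoupling J (Finset.Ico 0 (n : ℤ)) (i, i + d) := by
    rw [ENNReal.tsum_prod', ENNReal.tsum_comm (α := ℤ) (f := fun d i => exitCoupling J _ (i, i + d))]
    exact tsum_congr fun i => ((Equiv.addLeft i).tsum_eq _).symm
  rw [hre]
  refine ENNReal.tsum_le_tsum fun d => ?_
  -- The `|d|` sites next to the end through which the translation by `d` leaves; for `|d| > n` some
  -- of them lie outside the interval, which is harmless.
  let S : Finset ℤ := if 0 ≤ d then Finset.Ico (n - d) n else Finset.Ico 0 (-d)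
  have hS : S.card = d.natAbs := by
    by_cases hd : 0 ≤ d <;> simp [S, hd] <;> omega
  have hsupp : ∀ i ∉ S, exitCoupling J (Finset.Ico 0 (n : ℤ)) (i, i + d) = 0 := by
    intro i hi
    refine if_neg ?_
    by_cases hd : 0 ≤ d
    · simp only [S, if_pos hd, Finset.mem_Ico] at hi ⊢
      omega
    · simp only [S, if_neg hd, Finset.mem_Ico] at hi ⊢
      omega
  rw [tsum_eq_sum hsupp]
  calc ∑ i ∈ S, exitCoupling J (Finset.Ico 0 (n : ℤ)) (i, i + d)
      ≤ ∑ _i ∈ S, ‖J d.natAbs‖ₑ := by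
        refine Finset.sum_le_sum fun i _ => ?_
        unfold exitCoupling
        split_ifs
        · simp
        · exact zero_le
    _ = d.natAbs * ‖J d.natAbs‖ₑ := by simp [hS]

theorem tsum_natAbs_mul_enorm_ne_top {α : ℝ} (hα : 2 < α) {J : ℕ → ℝ}
    (hJ : J =O[atTop] fun k : ℕ => (k : ℝ) ^ (-α)) :
    ∑' d : ℤ, (d.natAbs : ℝ≥0∞) * ‖J d.natAbs‖ₑ ≠ ∞ := by
  have hN : Summable fun k : ℕ => (k : ℝ) * ‖J k‖ := by
    refine summable_of_isBigO_nat (g := fun k : ℕ => (k : ℝ) ^ (1 - α))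
      (Real.summable_nat_rpow.2 (by linarith)) ?_
    refine ((Asymptotics.isBigO_refl (fun k : ℕ => (k : ℝ)) atTop).mul hJ.norm_left).congr'
      EventuallyEq.rfl ?_
    filter_upwards [eventually_gt_atTop 0] with k hk
    have hk' : (0 : ℝ) < k := by exact_mod_cast hk
    rw [sub_eq_add_neg, Real.rpow_add hk', Real.rpow_one]
  have hZ : Summable fun d : ℤ => (d.natAbs : ℝ) * ‖J d.natAbs‖ :=
    Summable.of_nat_of_neg (by simpa using hN) (by simpa using hN)
  convert hZ.tsum_ofReal_ne_top using 4 with d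
  rw [ENNReal.ofReal_mul (by positivity), ofReal_norm, ENNReal.ofReal_natCast]

/-- The expected cost of raising an interval is bounded uniformly in its length. -/
theorem lintegral_raiseCost_Ico_le {p : ℝ} (hp1 : 1 ≤ p) (hp2 : p ≤ 2) (J : ℕ → ℝ)
    {μ : Measure Config} [IsProbabilityMeasure μ] (hμ : IsShiftInvariant μ) (n : ℕ) :
    ∫⁻ φ, raiseCost p J (Finset.Ico 0 (n : ℤ)) φ ∂μ
      ≤ 2 * (∑' d : ℤ, d.natAbs * ‖J d.natAbs‖ₑ) *
        (4 + 4 * ∫⁻ φ, ENNReal.ofReal |(φ 0 : ℝ)| ∂μ) := by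
  have hmeas : ∀ i : ℤ, Measurable fun φ : Config => ENNReal.ofReal |(φ i : ℝ)| := fun i =>
    (measurable_from_top (f := fun z : ℤ => ENNReal.ofReal |(z : ℝ)|)).comp (measurable_pi_apply i)
  have hstat : ∀ i : ℤ, ∫⁻ φ, ENNReal.ofReal |(φ i : ℝ)| ∂μ
      = ∫⁻ φ, ENNReal.ofReal |(φ 0 : ℝ)| ∂μ := by
    intro i
    conv_rhs => rw [← hμ i]
    rw [lintegral_map (hmeas 0) (measurable_pi_lambda _ fun j => measurable_pi_apply (j + i))]
    simp
  set m := ∫⁻ φ, ENNReal.ofReal |(φ 0 : ℝ)| ∂μ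
  set Λ := Finset.Ico 0 (n : ℤ)
  have hterm : ∀ ij : ℤ × ℤ,
      ∫⁻ φ, ‖energyTerm p J Λ (raise Λ 1 φ) ij - energyTerm p J Λ φ ij‖ₑ ∂μ
        ≤ (exitCoupling J Λ ij + exitCoupling J Λ ij.swap) * (4 + 4 * m) := by
    intro ij
    refine (lintegral_mono fun φ => enorm_energyTerm_raise_sub_le hp1 hp2 J Λ φ ij).trans ?_
    rw [lintegral_const_mul _ (by fun_prop), lintegral_add_left (by fun_prop),
      lintegral_const_mul _ (by fun_prop), lintegral_add_left (by fun_prop), hstat, hstat]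
    simp only [lintegral_const, measure_univ, mul_one]
    refine le_of_eq ?_
    ring
  unfold raiseCost
  rw [lintegral_tsum fun ij =>
    (measurable_enorm_energyTerm_raise_sub p J Λ ij).aemeasurable]
  refine (ENNReal.tsum_le_tsum hterm).trans ?_
  rw [ENNReal.tsum_mul_right, ENNReal.tsum_add]
  gcongr
  rw [two_mul]
  refine add_le_add (tsum_exitCoupling_Ico_le J n) ?_
  exact ((Equiv.prodComm ℤ ℤ).tsum_eq (exitCoupling J Λ)).le.trans (tsum_exitCoupling_Ico_le J n)

/-! ### Average heights and the contradiction. -/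

/-- The average height over `{0, …, n - 1}`. -/
noncomputable def meanHeight (n : ℕ) (φ : Config) : ℝ :=
  (n : ℝ)⁻¹ * ∑ k ∈ Finset.range n, (φ k : ℝ)

theorem measurable_coe_apply (i : ℤ) : Measurable fun φ : Config => (φ i : ℝ) :=
  (measurable_from_top (f := fun z : ℤ => (z : ℝ))).comp (measurable_pi_apply i)

theorem measurable_meanHeight (n : ℕ) : Measurable (meanHeight n) := by
  unfold meanHeight
  exact (Finset.measurable_fun_sum _ fun (k : ℕ) _ => measurable_coe_apply k).const_mul _

theorem meanHeight_eq_birkhoffAverage (n : ℕ) :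
    meanHeight n
      = birkhoffAverage ℝ (fun (φ : Config) i => φ (i + 1)) (fun φ => (φ 0 : ℝ)) n := by
  have h : ∀ (k : ℕ) (φ : Config) (i : ℤ),
      (fun (φ : Config) i => φ (i + 1))^[k] φ i = φ (i + k) := by
    intro k
    induction k with
    | zero => simp
    | succ k ih =>
      intro φ i
      rw [Function.iterate_succ_apply, ih]
      congr 1
      push_cast
      ring
  ext φ
  simp [meanHeight, birkhoffAverage, birkhoffSum, h]

theorem meanHeight_raise {n m : ℕ} (hnm : n ≤ m) (φ : Config) :
    meanHeight m (raise (Finset.Ico 0 (n : ℤ)) 1 φ) = meanHeight m φ + (m : ℝ)⁻¹ * n := by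
  have hk : ∀ k : ℕ, ((raise (Finset.Ico 0 (n : ℤ)) 1 φ k : ℤ) : ℝ)
      = φ k + if k < n then 1 else 0 := by
    intro k
    by_cases h : k < n <;> simp [raise, h]
  have hf : (Finset.range m).filter (· < n) = Finset.range n := by
    ext k
    simp only [Finset.mem_filter, Finset.mem_range]
    omega
  simp only [meanHeight, hk, Finset.sum_add_distrib, Finset.sum_boole, hf, Finset.card_range,
    mul_add]

/-- The mean ergodic theorem for average heights. -/
theorem exists_lintegral_meanHeight_sub_le {μ : Measure Config} [IsProbabilityMeasure μ]
    (hμ : IsShiftInvariant μ) (hm : ∫⁻ φ, ENNReal.ofReal |(φ 0 : ℝ)| ∂μ ≠ ∞)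
    {ε : ℝ≥0∞} (hε : ε ≠ 0) :
    ∃ N : ℕ, ∀ n ≥ N, ∀ m ≥ N, ∫⁻ φ, ‖meanHeight n φ - meanHeight m φ‖ₑ ∂μ ≤ ε := by
  have hT : MeasurePreserving (fun (φ : Config) i => φ (i + 1)) μ μ :=
    ⟨measurable_pi_lambda _ fun i => measurable_pi_apply (i + 1), hμ 1⟩
  have hf : MemLp (fun φ : Config => (φ 0 : ℝ)) 1 μ := by
    refine ⟨(measurable_coe_apply 0).aestronglyMeasurable, ?_⟩
    rw [eLpNorm_one_eq_lintegral_enorm]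
    simpa only [Real.enorm_eq_ofReal_abs] using hm.lt_top
  obtain ⟨N, hN⟩ := exists_eLpNorm_one_birkhoffAverage_sub_le hT hf hε
  refine ⟨N, fun n hn m hm' => ?_⟩
  have := hN n hn m hm'
  rwa [eLpNorm_one_eq_lintegral_enorm, ← meanHeight_eq_birkhoffAverage,
    ← meanHeight_eq_birkhoffAverage] at this

/-- Delocalisation: a shift-invariant Gibbs measure has no first moment. -/
theorem IsGibbs.lintegral_abs_eq_top {β α p : ℝ} (hβ : 0 < β) (hα : 2 < α) (hp1 : 1 ≤ p)
    (hp2 : p ≤ 2) {J : ℕ → ℝ} (hJ : J =O[atTop] fun k : ℕ => (k : ℝ) ^ (-α))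
    {μ : Measure Config} (hG : IsGibbs β p J μ) (hμ : IsShiftInvariant μ) :
    ∫⁻ φ, ENNReal.ofReal |(φ 0 : ℝ)| ∂μ = ∞ := by
  by_contra hm
  have := hG.isProbabilityMeasure
  obtain ⟨c, hc⟩ : ∃ c : ℝ≥0, ∀ n : ℕ,
      ∫⁻ φ, raiseCost p J (Finset.Ico 0 (n : ℤ)) φ ∂μ ≤ c := by
    have hfin : 2 * (∑' d : ℤ, d.natAbs * ‖J d.natAbs‖ₑ) *
        (4 + 4 * ∫⁻ φ, ENNReal.ofReal |(φ 0 : ℝ)| ∂μ) ≠ ∞ := by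
      have := tsum_natAbs_mul_enorm_ne_top hα hJ
      finiteness
    lift 2 * (∑' d : ℤ, d.natAbs * ‖J d.natAbs‖ₑ) *
        (4 + 4 * ∫⁻ φ, ENNReal.ofReal |(φ 0 : ℝ)| ∂μ) to ℝ≥0 using hfin with c hc
    refine ⟨c, fun n => ?_⟩
    rw [hc]
    exact lintegral_raiseCost_Ico_le hp1 hp2 J hμ n
  -- Markov's inequality then gives cost at least `K` with probability at most 1/4; the `+ 1` keeps
  -- `K` positive when `c = 0`.
  let K : ℝ≥0 := 4 * c + 1
  let δ : ℝ≥0 := Real.toNNReal (Real.exp (-β * K))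
  have hδ : 0 < δ := Real.toNNReal_pos.2 (Real.exp_pos _)
  -- The bound 1/16 makes `‖g‖ₑ ≥ 1/4` have probability at most 1/4; the bound `δ / 8` makes `‖g‖ₑ ≥
  -- 1/2` have probability at most `δ / 4`, below the lower bound `δ / 2`.
  let ε : ℝ≥0 := min (1 / 16) (δ / 8)
  have hε : 0 < ε := lt_min (by norm_num) (by positivity)
  obtain ⟨N, hN⟩ := exists_lintegral_meanHeight_sub_le hμ hm
    (ε := ε) (by exact_mod_cast hε.ne')
  let n := N + 1
  have hdev := hN n (by omega) (4 * n) (by omega)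
  let g : Config → ℝ := fun φ => meanHeight n φ - meanHeight (4 * n) φ
  have hg : Measurable g := (measurable_meanHeight n).sub (measurable_meanHeight (4 * n))
  let Λ := Finset.Ico 0 (n : ℤ)
  have hraise : ∀ φ, g (raise Λ 1 φ) = g φ + 3 / 4 := by
    intro φ
    have hn : (n : ℝ) ≠ 0 := by positivity
    simp only [g, Λ, meanHeight_raise le_rfl, meanHeight_raise (show n ≤ 4 * n by omega)]
    push_cast
    field_simp
    ring
  have markov : ∀ t : ℝ≥0, t ≠ 0 → μ {φ | (t : ℝ≥0∞) ≤ ‖g φ‖ₑ} ≤ (ε / t : ℝ≥0) := by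
    intro t ht
    refine (meas_ge_le_lintegral_div hg.enorm.aemeasurable (by exact_mod_cast ht)
      ENNReal.coe_ne_top).trans ?_
    rw [ENNReal.coe_div ht]
    gcongr
  have hcost : μ {φ | (K : ℝ≥0∞) ≤ raiseCost p J Λ φ} ≤ (c / K : ℝ≥0) := by
    have hK : K ≠ 0 := by positivity
    refine (meas_ge_le_lintegral_div (measurable_raiseCost p J Λ).aemeasurable
      (by exact_mod_cast hK) ENNReal.coe_ne_top).trans ?_
    rw [ENNReal.coe_div hK]
    gcongr
    exact hc n
  let F : Set Config := {φ | ‖g φ‖ₑ < (1 / 4 : ℝ≥0)} ∩ {φ | raiseCost p J Λ φ ≤ K}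
  have hF : MeasurableSet F :=
    (measurableSet_lt hg.enorm measurable_const).inter
      (measurableSet_le (measurable_raiseCost p J Λ) measurable_const)
  have hFc : μ Fᶜ ≤ (1 / 2 : ℝ≥0) := by
    have hsub : Fᶜ ⊆ {φ | ((1 / 4 : ℝ≥0) : ℝ≥0∞) ≤ ‖g φ‖ₑ} ∪
        {φ | (K : ℝ≥0∞) ≤ raiseCost p J Λ φ} := by
      intro φ hφ
      by_contra hcon
      simp only [Set.mem_union, Set.mem_ofPred_eq, not_or, not_le] at hcon
      exact hφ ⟨hcon.1, hcon.2.le⟩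
    refine (measure_mono hsub).trans ((measure_union_le _ _).trans
      ((add_le_add (markov _ (by norm_num)) hcost).trans ?_))
    have h1 : ε / (1 / 4) ≤ 1 / 4 := by
      rw [div_le_iff₀ (by norm_num)]
      exact (min_le_left _ _).trans (by norm_num)
    have h2 : c / K ≤ 1 / 4 := by
      rw [div_le_iff₀ (by positivity)]
      simp only [K, mul_add, ← mul_assoc]
      norm_num
    have h3 : (1 / 4 + 1 / 4 : ℝ≥0) = 1 / 2 := by norm_num
    exact_mod_cast (add_le_add h1 h2).trans h3.le
  have hFhalf : ((1 / 2 : ℝ≥0) : ℝ≥0∞) ≤ μ F := by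
    have h1 : (1 : ℝ≥0∞) ≤ μ F + (1 / 2 : ℝ≥0) := by
      rw [← prob_add_prob_compl (μ := μ) hF]
      gcongr
    have h2 : (1 : ℝ≥0∞) = (1 / 2 : ℝ≥0) + (1 / 2 : ℝ≥0) := by
      rw [← ENNReal.coe_add, add_halves, ENNReal.coe_one]
    rw [h2] at h1
    exact (ENNReal.add_le_add_iff_right ENNReal.coe_ne_top).1 h1
  -- This preimage is `F` raised by one: there `g` exceeds `-1/4 + 3/4`.
  have himage : raise Λ (-1) ⁻¹' F ⊆ {φ | ((1 / 2 : ℝ≥0) : ℝ≥0∞) ≤ ‖g φ‖ₑ} := by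
    intro φ hφ
    have hsmall : ‖g (raise Λ (-1) φ)‖ₑ < (1 / 4 : ℝ≥0) := hφ.1
    have heq := hraise (raise Λ (-1) φ)
    rw [raise_raise_neg] at heq
    rw [enorm_lt_coe, ← NNReal.coe_lt_coe, coe_nnnorm, Real.norm_eq_abs, abs_lt] at hsmall
    rw [Set.mem_ofPred_eq, coe_le_enorm, ← NNReal.coe_le_coe, coe_nnnorm, Real.norm_eq_abs, heq]
    push_cast at hsmall ⊢
    exact le_abs.2 (Or.inl (by linarith [hsmall.1]))
  have hlow := hG.mul_measure_le hβ Λ hF fun φ hφ => hφ.2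
  have hup := (measure_mono himage).trans (markov _ (by norm_num))
  have hfinal : (δ : ℝ≥0∞) * (1 / 2 : ℝ≥0) ≤ (ε / (1 / 2) : ℝ≥0) :=
    (mul_le_mul_right hFhalf _).trans (hlow.trans hup)
  have hfinal' : δ * (1 / 2) ≤ ε / (1 / 2) := by exact_mod_cast hfinal
  have hεδ : ε ≤ δ / 8 := min_le_right _ _
  have h1 : (δ : ℝ) * (1 / 2) ≤ ε / (1 / 2) := by exact_mod_cast hfinal'
  have h2 : (ε : ℝ) ≤ δ / 8 := by exact_mod_cast hεδ
  have h3 : (0 : ℝ) < δ := by exact_mod_cast hδ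
  linarith

end LongRangeSOS

theorem theorem1 (β α : ℝ) (hβ : 0 < β) (hα : 2 < α) (J : ℕ → ℝ)
    (hJ : J =O[Filter.atTop] fun k : ℕ => (k : ℝ) ^ (-α)) :
    (∀ p : ℝ, p = 1 ∨ p = 2 →
      ¬ ∃ μ : MeasureTheory.Measure LongRangeSOS.Config,
        LongRangeSOS.IsGibbs β p J μ ∧ LongRangeSOS.IsShiftInvariant μ ∧
          ∃ C : ℝ≥0, ∫⁻ φ, ENNReal.ofReal |(φ 0 : ℝ)| ∂μ < (C : ℝ≥0∞)) ∧
    (∀ p : ℝ, 1 < p → p < 2 →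
      ¬ ∃ μ : MeasureTheory.Measure LongRangeSOS.Config,
        LongRangeSOS.IsGibbs β p J μ ∧ LongRangeSOS.IsShiftInvariant μ ∧
          ∃ C : ℝ≥0, ∫⁻ φ, ENNReal.ofReal ((φ 0 : ℝ) ^ 2) ∂μ < (C : ℝ≥0∞)) := by
  constructor
  · rintro p hp ⟨μ, hG, hμ, C, hC⟩
    have htop := hG.lintegral_abs_eq_top hβ hα (by rcases hp with rfl | rfl <;> norm_num)
      (by rcases hp with rfl | rfl <;> norm_num) hJ hμ
    exact not_top_lt (htop ▸ hC)
  · rintro p hp1 hp2 ⟨μ, hG, hμ, C, hC⟩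
    have htop := hG.lintegral_abs_eq_top hβ hα hp1.le hp2.le hJ hμ
    refine not_top_lt (htop ▸ (lintegral_mono fun φ => ENNReal.ofReal_le_ofReal ?_).trans_lt hC)
    -- Heights are integers, so the second moment dominates the first without an additive constant.
    have h : |φ 0| ≤ φ 0 ^ 2 := by
      rw [← sq_abs]
      exact Int.le_self_sq _
    exact_mod_cast h
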